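/- Let $V$ be a finite set of $n$ points whose $3$-element subsets are each coloured red or blue. For distinct $u,v\in V$ the red (resp. blue) line $uv$ is the set consisting of $u$, $v$ and all $p\in V\setminus\{u,v\}$ such that $\{u,v,p\}$ is red (resp. blue). Let $m(V)$ be the number of distinct red lines plus the number of distinct blue lines (red and blue lines are counted separately), and let $m_3(V)$ be the number of red lines with exactly three points. Let $X$ be either a Euclidean space $\mathbb{R}^d$ with $d\ge 2$ or the real projective plane. For a finite set $V\subset X$, colour a triple of points of $V$ red if it is collinear in $X$, and blue otherwise. Then the following hold, with constants that do not depend on $X$ or on $n$. 1. There is a constant $C$ such that for every $n\ge 0$ $$\frac13\binom n2\;\le\;\min_{V\subset X,\ |V|=n} m(V)\;\le\;\frac13\binom n2+Cn .$$ In particular the minimum is $\frac13\binom n2+O(n)=\frac{n^2}{6}+O(n)$. 2. There is a constant $A$ such that for every $n\ge 0$ there is a set $V\subset X$ of $n$ points with $m_3(V)\ge\frac13\binom n2-An$. 3. For every $A$ there is a constant $C_A$ such that every set $V\subset X$ of $n$ points with $m_3(V)\ge\frac13\binom n2-An$ satisfies $m(V)\le\frac13\binom n2+C_An$. -/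

import Mathlib

/-- The two colours. -/
inductive Colour where
  | red
  | blue

/-- A bi-coloured system on the point set `V`: every 3-element subset of `V` gets a colour. -/
structure BicolouredSystem (V : Type*) where
  colour : {t : Set V // t.ncard = 3} → Colour

namespace BicolouredSystem

variable {V : Type*} (S : BicolouredSystem V)

/-- The line of colour `c` generated by `u` and `v`: the points `u`, `v` and all points `p`
such that `{u, v, p}` is a triple of colour `c`. -/
def line (c : Colour) (u v : V) : Set V :=
  {u, v} ∪ {p | ∃ h : ({u, v, p} : Set V).ncard = 3, S.colour ⟨{u, v, p}, h⟩ = c}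

/-- The set of all lines of colour `c`. -/
def lines (c : Colour) : Set (Set V) :=
  {L | ∃ u v : V, u ≠ v ∧ L = S.line c u v}

/-- The number of distinct red lines plus the number of distinct blue lines. -/
noncomputable def numLines : ℕ :=
  (S.lines Colour.red).ncard + (S.lines Colour.blue).ncard

/-- The number of red lines that consist of exactly three points. -/
noncomputable def numThreePointRedLines : ℕ :=
  {L ∈ S.lines Colour.red | L.ncard = 3}.ncard

end BicolouredSystem

open Classical in
/-- The bi-coloured system on a finite set `P` of points of `X` whose red triples are
the triples satisfying `coll`, regarded as the collinearity of subsets of `X`. -/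
noncomputable def collinearSystem {X : Type*} (coll : Set X → Prop) (P : Finset X) :
    BicolouredSystem P where
  colour t := if coll (Subtype.val '' t.1) then Colour.red else Colour.blue

/-- Collinearity in the Euclidean space of dimension `d`. -/
def euclideanCollinear (d : ℕ) (s : Set (EuclideanSpace ℝ (Fin d))) : Prop :=
  Collinear ℝ s

/-- The real projective plane. -/
abbrev RealProjectivePlane : Type := Projectivization ℝ (Fin 3 → ℝ)

/-- Collinearity in the real projective plane. -/
def projectiveCollinear (s : Set RealProjectivePlane) : Prop :=
  Projectivization.IsCollinear s

/-- The values taken by the total number of lines on the systems derived from `n` points. -/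
def totals {X : Type*} (coll : Set X → Prop) (n : ℕ) : Set ℕ :=
  {m | ∃ P : Finset X, P.card = n ∧ m = (collinearSystem coll P).numLines}

/-- In a Euclidean space collinearity of a triple is the metric notion: for some ordering of
the triple, two of the distances add up to the third. -/
theorem euclideanCollinear_triple_iff {d : ℕ} (a b c : EuclideanSpace ℝ (Fin d)) :
    euclideanCollinear d {a, b, c} ↔
      dist a b + dist b c = dist a c ∨ dist b c + dist c a = dist b a ∨
        dist c a + dist a b = dist c b := by
  rw [dist_add_dist_eq_iff, dist_add_dist_eq_iff, dist_add_dist_eq_iff]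
  refine ⟨fun h => Collinear.wbtw_or_wbtw_or_wbtw h, ?_⟩
  rintro (h | h | h)
  · exact h.collinear
  · have e : ({a, b, c} : Set (EuclideanSpace ℝ (Fin d))) = {b, c, a} := by ext; simp; tauto
    exact e ▸ h.collinear
  · have e : ({a, b, c} : Set (EuclideanSpace ℝ (Fin d))) = {c, a, b} := by ext; simp; tauto
    exact e ▸ h.collinear

/-!
A red line with at most three points accounts for at most six ordered pairs of points. The pairs
`{a, b}` on a red line with more than three points generate different blue lines: the complement of
the blue line `ab` has at least two points, which determine the red line `ab`, and the red and the
blue line meet exactly in `{a, b}`. Hence the number of ordered pairs is at most six times the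
number of red lines plus twice the number of blue lines, which gives the lower bound. If all but
`O(n)` pairs lie on three-point red lines, there are `C(n,2)/3 - O(n)` of these, the blue line of
such a pair is the complement of a point, and the other pairs add only `O(n)` lines.

Almost all pairs lie on three-point lines if the points are a coset of a finite subgroup of a cubic
curve. On the cubic `y = x / (1 + x ^ 2)` the points with abscissas `tan α`, `tan β`, `tan γ` are
collinear exactly if `α + β + γ` is a multiple of `π`. The coset avoids the point at infinity, so it
lies in the affine plane, and hence in every space that contains a copy of this plane.
-/

namespace BicolouredSystem

variable {V : Type*} {S : BicolouredSystem V} {u v a b p : V}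

/-- The red lines form a linear space: a red line is generated by any two of its points. -/
def IsLinear (S : BicolouredSystem V) : Prop :=
  ∀ ⦃u v a b : V⦄, u ≠ v → a ≠ b → a ∈ S.line Colour.red u v → b ∈ S.line Colour.red u v →
    S.line Colour.red a b = S.line Colour.red u v

theorem left_mem_line (c : Colour) (u v : V) : u ∈ S.line c u v := by simp [line]

theorem right_mem_line (c : Colour) (u v : V) : v ∈ S.line c u v := by simp [line]

theorem pair_subset_line (c : Colour) (u v : V) : {u, v} ⊆ S.line c u v :=
  Set.subset_union_left

theorem mem_line_iff_colour_eq {c : Colour} (huv : u ≠ v) (hup : u ≠ p) (hvp : v ≠ p) :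
    p ∈ S.line c u v ↔
      S.colour ⟨{u, v, p}, Set.ncard_eq_three.2 ⟨u, v, p, huv, hup, hvp, rfl⟩⟩ = c := by
  have hcard : ({u, v, p} : Set V).ncard = 3 :=
    Set.ncard_eq_three.2 ⟨u, v, p, huv, hup, hvp, rfl⟩
  simp [line, hup.symm, hvp.symm, hcard]

theorem compl_line_blue (huv : u ≠ v) :
    (S.line Colour.blue u v)ᶜ = S.line Colour.red u v \ {u, v} := by
  ext p
  rcases eq_or_ne u p with rfl | hup
  · simp [left_mem_line]
  rcases eq_or_ne v p with rfl | hvp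
  · simp [right_mem_line]
  rw [Set.mem_compl_iff, Set.mem_sdiff, mem_line_iff_colour_eq huv hup hvp,
    mem_line_iff_colour_eq huv hup hvp]
  cases S.colour _ <;> simp [hup.symm, hvp.symm]

theorem line_red_inter_line_blue (huv : u ≠ v) :
    S.line Colour.red u v ∩ S.line Colour.blue u v = {u, v} := by
  rw [← compl_compl (S.line Colour.blue u v), compl_line_blue huv, ← Set.sdiff_eq,
    Set.sdiff_sdiff_cancel_left (pair_subset_line _ _ _)]

theorem exists_line_blue_eq_compl_singleton (huv : u ≠ v)
    (h : (S.line Colour.red u v).ncard = 3) : ∃ w, S.line Colour.blue u v = {w}ᶜ := by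
  have hcard : (S.line Colour.red u v \ {u, v}).ncard = 1 := by
    rw [Set.ncard_sdiff (pair_subset_line _ _ _), h, Set.ncard_pair huv]
  obtain ⟨w, hw⟩ := Set.ncard_eq_one.1 hcard
  exact ⟨w, by rw [← hw, ← compl_line_blue huv, compl_compl]⟩

theorem IsLinear.line_red_eq_of_line_blue_eq (hS : S.IsLinear) (hab : a ≠ b) (huv : u ≠ v)
    (hcard : 3 < (S.line Colour.red a b).ncard)
    (hblue : S.line Colour.blue u v = S.line Colour.blue a b) :
    S.line Colour.red u v = S.line Colour.red a b := by
  have hrest : S.line Colour.red a b \ {a, b} = S.line Colour.red u v \ {u, v} := by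
    rw [← compl_line_blue hab, ← compl_line_blue huv, hblue]
  have htwo : 1 < (S.line Colour.red a b \ {a, b}).ncard := by
    rw [Set.ncard_sdiff (pair_subset_line _ _ _), Set.ncard_pair hab]
    lia
  obtain ⟨c, hc, d, hd, hcd⟩ :=
    (Set.one_lt_ncard (Set.finite_of_ncard_pos (Nat.zero_lt_of_lt htwo))).1 htwo
  have hcd_ab : S.line Colour.red c d = S.line Colour.red a b := hS hab hcd hc.1 hd.1
  rw [hrest] at hc hd
  rw [← hcd_ab, hS huv hcd hc.1 hd.1]

theorem IsLinear.pair_eq_of_line_blue_eq (hS : S.IsLinear) (hab : a ≠ b) (huv : u ≠ v)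
    (hcard : 3 < (S.line Colour.red a b).ncard)
    (hblue : S.line Colour.blue u v = S.line Colour.blue a b) :
    u = a ∧ v = b ∨ u = b ∧ v = a := by
  rw [← Set.pair_eq_pair_iff, ← line_red_inter_line_blue huv, ← line_red_inter_line_blue hab,
    hblue, hS.line_red_eq_of_line_blue_eq hab huv hcard hblue]

section Counting

open Finset

variable [Fintype V]

open Classical in
/-- The ordered pairs of distinct points that generate a red line with the property `p`. Sorting
them by this line is the double counting behind all the bounds. -/
noncomputable def redPairs (S : BicolouredSystem V) (p : Set V → Prop) : Finset (V × V) :=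
  {x ∈ univ.offDiag | p (S.line Colour.red x.1 x.2)}

theorem mem_redPairs {p : Set V → Prop} {x : V × V} :
    x ∈ S.redPairs p ↔ x.1 ≠ x.2 ∧ p (S.line Colour.red x.1 x.2) := by
  simp [redPairs]

theorem card_redPairs_add_card_redPairs_not (S : BicolouredSystem V) (p : Set V → Prop) :
    #(S.redPairs p) + #(S.redPairs fun L => ¬ p L) = 2 * (Fintype.card V).choose 2 := by
  classical
  rw [redPairs, redPairs, card_filter_add_card_filter_not, offDiag_card, card_univ,
    Nat.choose_two_right, Nat.mul_div_cancel' (Nat.even_mul_pred_self _).two_dvd, Nat.mul_sub_one]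

open Classical in
theorem IsLinear.filter_redPairs_line_eq (hS : S.IsLinear) {p : Set V → Prop} {L : Set V}
    (hL : L ∈ S.lines Colour.red) (hp : p L) :
    {x ∈ S.redPairs p | S.line Colour.red x.1 x.2 = L} = L.toFinset.offDiag := by
  obtain ⟨u, v, huv, rfl⟩ := hL
  ext ⟨a, b⟩
  simp only [mem_filter, mem_redPairs, mem_offDiag, Set.mem_toFinset]
  constructor
  · rintro ⟨⟨hab, -⟩, h⟩
    exact ⟨h ▸ left_mem_line _ _ _, h ▸ right_mem_line _ _ _, hab⟩
  · rintro ⟨ha, hb, hab⟩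
    have h := hS huv hab ha hb
    exact ⟨⟨hab, h ▸ hp⟩, h⟩

theorem IsLinear.card_redPairs_eq_sum (hS : S.IsLinear) (p : Set V → Prop) :
    #(S.redPairs p) =
      ∑ L ∈ (Set.toFinite {L ∈ S.lines Colour.red | p L}).toFinset, L.ncard * (L.ncard - 1) := by
  classical
  have hmaps : ∀ x ∈ S.redPairs p, S.line Colour.red x.1 x.2 ∈
      (Set.toFinite {L ∈ S.lines Colour.red | p L}).toFinset := fun x hx =>
    (Set.Finite.mem_toFinset _).2
      ⟨⟨x.1, x.2, (mem_redPairs.1 hx).1, rfl⟩, (mem_redPairs.1 hx).2⟩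
  rw [card_eq_sum_card_fiberwise hmaps]
  refine sum_congr rfl fun L hL => ?_
  obtain ⟨hL, hp⟩ := (Set.Finite.mem_toFinset _).1 hL
  rw [hS.filter_redPairs_line_eq hL hp, offDiag_card, ← Set.ncard_eq_toFinset_card',
    Nat.mul_sub_one]

theorem IsLinear.card_redPairs_ncard_eq_three (hS : S.IsLinear) :
    #(S.redPairs fun L => L.ncard = 3) = 6 * S.numThreePointRedLines := by
  rw [hS.card_redPairs_eq_sum, numThreePointRedLines, Set.ncard_eq_toFinset_card _, mul_comm]
  refine sum_const_nat fun L hL => ?_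
  have hcard : L.ncard = 3 := ((Set.Finite.mem_toFinset _).1 hL).2
  rw [hcard]

theorem IsLinear.card_redPairs_ncard_le_three_le (hS : S.IsLinear) :
    #(S.redPairs fun L => L.ncard ≤ 3) ≤ 6 * (S.lines Colour.red).ncard := by
  have hsub : {L ∈ S.lines Colour.red | L.ncard ≤ 3} ⊆ S.lines Colour.red := Set.sep_subset _ _
  rw [hS.card_redPairs_eq_sum, mul_comm]
  refine (sum_le_card_nsmul _ _ 6 fun L hL => ?_).trans ?_
  · have hcard : L.ncard ≤ 3 := ((Set.Finite.mem_toFinset _).1 hL).2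
    exact Nat.mul_le_mul hcard (Nat.sub_le_sub_right hcard 1)
  · rw [← Set.ncard_eq_toFinset_card, smul_eq_mul]
    exact Nat.mul_le_mul_right 6 (Set.ncard_le_ncard hsub (Set.toFinite _))

theorem IsLinear.card_redPairs_three_lt_ncard_le (hS : S.IsLinear) :
    #(S.redPairs fun L => ¬ L.ncard ≤ 3) ≤ 2 * (S.lines Colour.blue).ncard := by
  classical
  rw [Set.ncard_eq_toFinset_card']
  have hmaps : ∀ x ∈ S.redPairs fun L => ¬ L.ncard ≤ 3,
      S.line Colour.blue x.1 x.2 ∈ (S.lines Colour.blue).toFinset := fun x hx =>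
    Set.mem_toFinset.2 ⟨x.1, x.2, (mem_redPairs.1 hx).1, rfl⟩
  refine card_le_mul_card_image_of_maps_to hmaps 2 fun L _ => ?_
  obtain hempty | ⟨⟨a, b⟩, hab⟩ :=
    {x ∈ S.redPairs fun L => ¬ L.ncard ≤ 3 | S.line Colour.blue x.1 x.2 = L}.eq_empty_or_nonempty
  · rw [hempty, card_empty]
    exact Nat.zero_le 2
  refine (card_le_card (t := {(a, b), (b, a)}) fun ⟨u, v⟩ huv => ?_).trans card_le_two
  simp only [mem_filter, mem_redPairs, not_le] at hab huv
  obtain ⟨⟨hab, hcard⟩, rfl⟩ := hab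
  obtain ⟨⟨huv, -⟩, hblue⟩ := huv
  simpa using hS.pair_eq_of_line_blue_eq hab huv hcard hblue

theorem IsLinear.choose_two_le_three_mul_numLines (hS : S.IsLinear) :
    (Fintype.card V).choose 2 ≤ 3 * S.numLines := by
  have hpairs := S.card_redPairs_add_card_redPairs_not fun L => L.ncard ≤ 3
  have hred := hS.card_redPairs_ncard_le_three_le
  have hblue := hS.card_redPairs_three_lt_ncard_le
  rw [numLines]
  lia

theorem IsLinear.six_mul_numThreePointRedLines_add (hS : S.IsLinear) :
    6 * S.numThreePointRedLines + #(S.redPairs fun L => L.ncard ≠ 3) =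
      2 * (Fintype.card V).choose 2 := by
  rw [← hS.card_redPairs_ncard_eq_three]
  exact S.card_redPairs_add_card_redPairs_not _

theorem ncard_lines_le_ncard_add_card_redPairs_not (c : Colour) (p : Set V → Prop)
    {T : Set (Set V)} (hT : ∀ u v, u ≠ v → p (S.line Colour.red u v) → S.line c u v ∈ T) :
    (S.lines c).ncard ≤ T.ncard + #(S.redPairs fun L => ¬ p L) := by
  classical
  have hcover : S.lines c ⊆
      T ∪ ((S.redPairs fun L => ¬ p L).image fun x => S.line c x.1 x.2 : Finset (Set V)) := by
    rintro L ⟨u, v, huv, rfl⟩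
    by_cases hp : p (S.line Colour.red u v)
    · exact Or.inl (hT u v huv hp)
    · exact Or.inr (mem_coe.2 (mem_image.2 ⟨(u, v), mem_redPairs.2 ⟨huv, hp⟩, rfl⟩))
  refine (Set.ncard_le_ncard hcover (Set.toFinite _)).trans ((Set.ncard_union_le _ _).trans ?_)
  rw [Set.ncard_coe_finset]
  exact Nat.add_le_add_left card_image_le _

theorem numLines_le_numThreePointRedLines_add (S : BicolouredSystem V) :
    S.numLines ≤ S.numThreePointRedLines + Fintype.card V +
      2 * #(S.redPairs fun L => L.ncard ≠ 3) := by
  have hred : (S.lines Colour.red).ncard ≤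
      S.numThreePointRedLines + #(S.redPairs fun L => L.ncard ≠ 3) :=
    ncard_lines_le_ncard_add_card_redPairs_not _ (fun L => L.ncard = 3)
      fun u v huv h => ⟨⟨u, v, huv, rfl⟩, h⟩
  have hblue : (S.lines Colour.blue).ncard ≤
      (Set.range fun w : V => ({w}ᶜ : Set V)).ncard + #(S.redPairs fun L => L.ncard ≠ 3) :=
    ncard_lines_le_ncard_add_card_redPairs_not _ (fun L => L.ncard = 3) fun u v huv h =>
      (exists_line_blue_eq_compl_singleton huv h).imp fun _ hw => hw.symm
  rw [Set.ncard_range_of_injective fun v w h => Set.singleton_injective (compl_injective h),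
    Nat.card_eq_fintype_card] at hblue
  rw [numLines]
  lia

theorem IsLinear.numLines_le (hS : S.IsLinear) {A : ℝ}
    (hA : ((Fintype.card V).choose 2 : ℝ) / 3 - A * Fintype.card V ≤ S.numThreePointRedLines) :
    (S.numLines : ℝ) ≤ ((Fintype.card V).choose 2 : ℝ) / 3 + (11 * A + 1) * Fintype.card V := by
  have hpairs := congrArg (Nat.cast (R := ℝ)) hS.six_mul_numThreePointRedLines_add
  have hlines := Nat.cast_le (α := ℝ) |>.2 S.numLines_le_numThreePointRedLines_add
  push_cast at hpairs hlines
  linarith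

theorem card_redPairs_ncard_ne_three_le {G : Type*} [AddCommGroup G] (e : G ≃ V) (c : G)
    (hline : ∀ i j, i ≠ j → S.line Colour.red (e i) (e j) = {e i, e j, e (c - i - j)}) :
    #(S.redPairs fun L => L.ncard ≠ 3) ≤ 2 * Fintype.card V := by
  classical
  let tangent : V → V := fun v => e (c - e.symm v - e.symm v)
  have hcover : (S.redPairs fun L => L.ncard ≠ 3) ⊆
      univ.image (fun v => (v, tangent v)) ∪ univ.image (fun v => (tangent v, v)) := by
    rintro ⟨u, v⟩ huv
    obtain ⟨i, rfl⟩ := e.surjective u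
    obtain ⟨j, rfl⟩ := e.surjective v
    obtain ⟨huv, hcard⟩ := mem_redPairs.1 huv
    have hij : i ≠ j := fun h => huv (congrArg e h)
    have htangent : c - i - j = i ∨ c - i - j = j := by
      by_contra! hne
      exact hcard (hline i j hij ▸ Set.ncard_eq_three.2
        ⟨_, _, _, huv, e.injective.ne hne.1.symm, e.injective.ne hne.2.symm, rfl⟩)
    simp only [tangent, mem_union, mem_image, mem_univ, true_and, Prod.mk.injEq]
    refine htangent.imp (fun h => ⟨e i, rfl, congrArg e ?_⟩) fun h => ⟨e j, congrArg e ?_, rfl⟩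
    · rw [e.symm_apply_apply, ← sub_eq_zero, ← sub_eq_zero.2 h]
      abel
    · rw [e.symm_apply_apply, ← sub_eq_zero, ← sub_eq_zero.2 h]
      abel
  refine (card_le_card hcover).trans ((card_union_le _ _).trans ?_)
  rw [two_mul]
  exact Nat.add_le_add card_image_le card_image_le

theorem IsLinear.le_numThreePointRedLines (hS : S.IsLinear) {G : Type*} [AddCommGroup G]
    (e : G ≃ V) (c : G)
    (hline : ∀ i j, i ≠ j → S.line Colour.red (e i) (e j) = {e i, e j, e (c - i - j)}) :
    ((Fintype.card V).choose 2 : ℝ) / 3 - 1 / 3 * Fintype.card V ≤ S.numThreePointRedLines := by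
  have hpairs := congrArg (Nat.cast (R := ℝ)) hS.six_mul_numThreePointRedLines_add
  have hbad := Nat.cast_le (α := ℝ) |>.2 (card_redPairs_ncard_ne_three_le e c hline)
  push_cast at hpairs hbad
  linarith

end Counting

end BicolouredSystem

/-- Abstract collinearity on `X`, for which two points lie on a common line and three points of
the line through two distinct points are collinear. -/
structure IsLineGeometry {X : Type*} (coll : Set X → Prop) : Prop where
  pair : ∀ a b : X, coll {a, b}
  triple : ∀ u v a b c : X, u ≠ v → coll {u, v, a} → coll {u, v, b} → coll {u, v, c} →
    coll {a, b, c}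

namespace IsLineGeometry

open BicolouredSystem

variable {X : Type*} {coll : Set X → Prop} {P : Finset X}

theorem mem_line_red_iff (h : IsLineGeometry coll) {u v p : P} (huv : u ≠ v) :
    p ∈ (collinearSystem coll P).line Colour.red u v ↔ coll {(u : X), (v : X), (p : X)} := by
  rcases eq_or_ne u p with rfl | hup
  · simpa [left_mem_line, Set.pair_comm (v : X)] using h.pair u v
  rcases eq_or_ne v p with rfl | hvp
  · simpa [right_mem_line] using h.pair u v
  simp [mem_line_iff_colour_eq huv hup hvp, collinearSystem, Set.image_insert_eq]

theorem line_red_subset (h : IsLineGeometry coll) {u v a b : P} (huv : u ≠ v) (hab : a ≠ b)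
    (ha : a ∈ (collinearSystem coll P).line Colour.red u v)
    (hb : b ∈ (collinearSystem coll P).line Colour.red u v) :
    (collinearSystem coll P).line Colour.red u v ⊆
      (collinearSystem coll P).line Colour.red a b := by
  intro p hp
  rw [h.mem_line_red_iff huv] at ha hb hp
  rw [h.mem_line_red_iff hab]
  exact h.triple _ _ _ _ _ (Subtype.coe_injective.ne huv) ha hb hp

theorem isLinear (h : IsLineGeometry coll) (P : Finset X) :
    (collinearSystem coll P).IsLinear := by
  intro u v a b huv hab ha hb
  have hsub := h.line_red_subset huv hab ha hb
  exact (h.line_red_subset hab huv (hsub (left_mem_line _ _ _))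
    (hsub (right_mem_line _ _ _))).antisymm hsub

section Group

variable {G : Type*} [AddCommGroup G] {c : G}

theorem line_red_eq (h : IsLineGeometry coll) (e : G ≃ P)
    (he : ∀ i j k, i ≠ j → i ≠ k → j ≠ k →
      (coll {(e i : X), (e j : X), (e k : X)} ↔ i + j + k = c))
    {i j : G} (hij : i ≠ j) :
    (collinearSystem coll P).line Colour.red (e i) (e j) = {e i, e j, e (c - i - j)} := by
  ext p
  obtain ⟨k, rfl⟩ := e.surjective p
  rcases eq_or_ne i k with rfl | hik
  · simp [left_mem_line]
  rcases eq_or_ne j k with rfl | hjk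
  · simp [right_mem_line]
  rw [h.mem_line_red_iff (e.injective.ne hij), he i j k hij hik hjk]
  simp [hik.symm, hjk.symm, sub_sub, eq_sub_iff_add_eq']

theorem exists_le_numThreePointRedLines [Fintype G] (h : IsLineGeometry coll) {q : G → X}
    (hq : Function.Injective q)
    (hcoll : ∀ i j k, i ≠ j → i ≠ k → j ≠ k → (coll {q i, q j, q k} ↔ i + j + k = c)) :
    ∃ P : Finset X, P.card = Fintype.card G ∧
      ((Fintype.card G).choose 2 : ℝ) / 3 - 1 / 3 * Fintype.card G ≤
        (collinearSystem coll P).numThreePointRedLines := by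
  let P : Finset X := Finset.univ.map ⟨q, hq⟩
  let e : G ≃ P := Equiv.ofBijective (fun i => ⟨q i, by simp [P]⟩)
    ⟨fun i j hij => hq (congrArg Subtype.val hij), fun ⟨x, hx⟩ => by simpa [P] using hx⟩
  have hP : P.card = Fintype.card G := Finset.card_map _
  have hbound := (h.isLinear P).le_numThreePointRedLines e c
    fun i j hij => h.line_red_eq e hcoll hij
  rw [Fintype.card_coe, hP] at hbound
  exact ⟨P, hP, hbound⟩

end Group

theorem choose_two_div_three_le_numLines (h : IsLineGeometry coll) (P : Finset X) :
    (P.card.choose 2 : ℝ) / 3 ≤ (collinearSystem coll P).numLines := by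
  have hlower := (h.isLinear P).choose_two_le_three_mul_numLines
  rw [Fintype.card_coe] at hlower
  rw [div_le_iff₀' three_pos]
  exact_mod_cast hlower

theorem numLines_le (h : IsLineGeometry coll) {A : ℝ}
    (hA : (P.card.choose 2 : ℝ) / 3 - A * P.card ≤
      (collinearSystem coll P).numThreePointRedLines) :
    ((collinearSystem coll P).numLines : ℝ) ≤
      (P.card.choose 2 : ℝ) / 3 + (11 * A + 1) * P.card := by
  simpa only [Fintype.card_coe] using
    (h.isLinear P).numLines_le (A := A) (by simpa only [Fintype.card_coe] using hA)

theorem exists_isLeast_totals (h : IsLineGeometry coll) {A : ℝ}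
    (hA : (P.card.choose 2 : ℝ) / 3 - A * P.card ≤
      (collinearSystem coll P).numThreePointRedLines) :
    ∃ m : ℕ, IsLeast (totals coll P.card) m ∧ (P.card.choose 2 : ℝ) / 3 ≤ m ∧
      (m : ℝ) ≤ (P.card.choose 2 : ℝ) / 3 + (11 * A + 1) * P.card := by
  have hmem : (collinearSystem coll P).numLines ∈ totals coll P.card := ⟨P, rfl, rfl⟩
  have hleast : IsLeast (totals coll P.card) (sInf (totals coll P.card)) :=
    ⟨Nat.sInf_mem ⟨_, hmem⟩, fun _ hm => Nat.sInf_le hm⟩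
  refine ⟨_, hleast, ?_, (Nat.cast_le.2 (hleast.2 hmem)).trans (h.numLines_le hA)⟩
  obtain ⟨Q, hQ, hm⟩ := hleast.1
  rw [hm, ← hQ]
  exact h.choose_two_div_three_le_numLines Q

end IsLineGeometry

section Cubic

theorem collinear_fin_two_iff_det_eq {K : Type*} [Field K] (p q r : Fin 2 → K) :
    Collinear K {p, q, r} ↔ (q 0 - p 0) * (r 1 - p 1) = (r 0 - p 0) * (q 1 - p 1) := by
  rw [collinear_iff_of_mem (p₀ := p) (by simp)]
  constructor
  · rintro ⟨v, hv⟩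
    obtain ⟨s, rfl⟩ := hv q (by simp)
    obtain ⟨t, rfl⟩ := hv r (by simp)
    simp only [vadd_eq_add, Pi.add_apply, Pi.smul_apply, smul_eq_mul, add_sub_cancel_right]
    ring
  · intro h
    rcases eq_or_ne p q with rfl | hpq
    · refine ⟨r - p, ?_⟩
      simp only [Set.mem_insert_iff, Set.mem_singleton_iff, forall_eq_or_imp, forall_eq]
      exact ⟨⟨0, by simp⟩, ⟨0, by simp⟩, ⟨1, by simp⟩⟩
    · have hr : ∃ t : K, r = t • (q - p) + p := by
        have hcross : ∀ i j, (q i - p i) * (r j - p j) = (r i - p i) * (q j - p j) := by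
          simp only [Fin.forall_fin_two, h, and_true]
          exact ⟨mul_comm _ _, by linear_combination -h, mul_comm _ _⟩
        obtain ⟨i, hi⟩ := Function.ne_iff.1 hpq
        have hsub : q i - p i ≠ 0 := sub_ne_zero.2 hi.symm
        refine ⟨(r i - p i) / (q i - p i), funext fun j => ?_⟩
        simp only [Pi.add_apply, Pi.smul_apply, Pi.sub_apply, smul_eq_mul]
        field_simp
        linear_combination hcross i j
      refine ⟨q - p, ?_⟩
      simp only [Set.mem_insert_iff, Set.mem_singleton_iff, forall_eq_or_imp, forall_eq]
      exact ⟨⟨0, by simp⟩, ⟨1, by simp⟩, hr⟩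

/-- The parametrization of the cubic `y = x / (1 + x ^ 2)`, whose group law is the addition of
angles in the parameter `tan θ`. -/
def cubicPoint {K : Type*} [Field K] (t : K) : Fin 2 → K :=
  ![t, t / (1 + t ^ 2)]

theorem cubicPoint_injective {K : Type*} [Field K] : Function.Injective (cubicPoint (K := K)) :=
  fun _ _ h => congrFun h 0

theorem collinear_cubicPoint_iff {K : Type*} [Field K] [LinearOrder K] [IsStrictOrderedRing K]
    {a b c : K} (hab : a ≠ b) (hac : a ≠ c) (hbc : b ≠ c) :
    Collinear K {cubicPoint a, cubicPoint b, cubicPoint c} ↔ a + b + c = a * b * c := by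
  have ha : 1 + a ^ 2 ≠ 0 := by positivity
  have hb : 1 + b ^ 2 ≠ 0 := by positivity
  have hc : 1 + c ^ 2 ≠ 0 := by positivity
  have hdet : (b - a) * (c / (1 + c ^ 2) - a / (1 + a ^ 2)) -
      (c - a) * (b / (1 + b ^ 2) - a / (1 + a ^ 2)) =
      (b - a) * (c - a) * (b - c) * (a + b + c - a * b * c) /
        ((1 + a ^ 2) * (1 + b ^ 2) * (1 + c ^ 2)) := by
    field_simp
    ring
  rw [collinear_fin_two_iff_det_eq, ← sub_eq_zero]
  change (b - a) * (c / (1 + c ^ 2) - a / (1 + a ^ 2)) -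
      (c - a) * (b / (1 + b ^ 2) - a / (1 + a ^ 2)) = 0 ↔ _
  rw [hdet]
  simp [sub_eq_zero, ha, hb, hc, hab.symm, hac.symm, hbc]

open Real

theorem tan_eq_tan_iff_sin_sub_eq_zero {x y : ℝ} (hx : cos x ≠ 0) (hy : cos y ≠ 0) :
    tan x = tan y ↔ sin (x - y) = 0 := by
  rw [tan_eq_sin_div_cos, tan_eq_sin_div_cos, div_eq_div_iff hx hy, sin_sub, sub_eq_zero,
    mul_comm (cos x)]

theorem tan_add_tan_add_tan_eq_mul_iff {x y z : ℝ} (hx : cos x ≠ 0) (hy : cos y ≠ 0)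
    (hz : cos z ≠ 0) :
    tan x + tan y + tan z = tan x * tan y * tan z ↔ sin (x + y + z) = 0 := by
  have hsin : sin (x + y + z) =
      (tan x + tan y + tan z - tan x * tan y * tan z) * (cos x * cos y * cos z) := by
    rw [sin_add, sin_add, cos_add]
    simp only [tan_eq_sin_div_cos]
    field_simp
    ring
  rw [hsin, mul_eq_zero_iff_right (by positivity), sub_eq_zero]

theorem sin_pi_mul_intCast_div_eq_zero_iff {n : ℕ} (hn : n ≠ 0) (m : ℤ) :
    sin (π * m / n) = 0 ↔ (n : ℤ) ∣ m := by
  have hn' : (n : ℝ) ≠ 0 := Nat.cast_ne_zero.2 hn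
  rw [sin_eq_zero_iff]
  refine exists_congr fun k => ?_
  rw [eq_div_iff hn', mul_right_comm, mul_comm π, mul_left_inj' pi_ne_zero, eq_comm, mul_comm]
  norm_cast

/-- The angles `π (j + 1/3) / n` for `0 ≤ j < n`. The shift by `1/3` keeps them off `π / 2`. -/
noncomputable def cubicAngle (n : ℕ) (j : ZMod n) : ℝ :=
  π * (3 * j.val + 1) / (3 * n)

section Angle

variable {n : ℕ} [NeZero n]

theorem cos_cubicAngle_ne_zero (j : ZMod n) : cos (cubicAngle n j) ≠ 0 := by
  have hn : (n : ℝ) ≠ 0 := NeZero.ne _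
  rw [cos_ne_zero_iff]
  intro k hk
  rw [cubicAngle, div_eq_div_iff (by positivity) two_ne_zero] at hk
  have hreal : (2 * (3 * j.val + 1) : ℝ) = 3 * ((2 * k + 1) * n) :=
    mul_left_cancel₀ pi_ne_zero (by linear_combination hk)
  have hint : (2 * (3 * j.val + 1) : ℤ) = 3 * ((2 * k + 1) * n) := by exact_mod_cast hreal
  lia

theorem sin_cubicAngle_sub_eq_zero_iff {i j : ZMod n} :
    sin (cubicAngle n i - cubicAngle n j) = 0 ↔ i = j := by
  have hn : (n : ℝ) ≠ 0 := NeZero.ne _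
  have hangle : cubicAngle n i - cubicAngle n j = π * ((i.val - j.val : ℤ) : ℝ) / n := by
    rw [cubicAngle, cubicAngle]
    push_cast
    field_simp
    ring
  rw [hangle, sin_pi_mul_intCast_div_eq_zero_iff (NeZero.ne n),
    ← ZMod.intCast_zmod_eq_zero_iff_dvd]
  simp [sub_eq_zero]

theorem sin_cubicAngle_add_add_eq_zero_iff {i j k : ZMod n} :
    sin (cubicAngle n i + cubicAngle n j + cubicAngle n k) = 0 ↔ i + j + k = -1 := by
  have hn : (n : ℝ) ≠ 0 := NeZero.ne _
  have hangle : cubicAngle n i + cubicAngle n j + cubicAngle n k =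
      π * ((i.val + j.val + k.val + 1 : ℤ) : ℝ) / n := by
    simp only [cubicAngle]
    push_cast
    field_simp
    ring
  rw [hangle, sin_pi_mul_intCast_div_eq_zero_iff (NeZero.ne n),
    ← ZMod.intCast_zmod_eq_zero_iff_dvd]
  simp [eq_neg_iff_add_eq_zero]

/-- The points of the cubic with the parameters `tan (cubicAngle n j)`. In its group law they form
a coset of the subgroup of order `n`. -/
noncomputable def cubicCosetPoint (n : ℕ) (j : ZMod n) : Fin 2 → ℝ :=
  cubicPoint (tan (cubicAngle n j))

theorem tan_cubicAngle_injective : Function.Injective fun j : ZMod n => tan (cubicAngle n j) :=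
  fun i j hij => sin_cubicAngle_sub_eq_zero_iff.1
    ((tan_eq_tan_iff_sin_sub_eq_zero (cos_cubicAngle_ne_zero i) (cos_cubicAngle_ne_zero j)).1 hij)

theorem cubicCosetPoint_injective : Function.Injective (cubicCosetPoint n) :=
  cubicPoint_injective.comp tan_cubicAngle_injective

theorem collinear_cubicCosetPoint_iff {i j k : ZMod n} (hij : i ≠ j) (hik : i ≠ k)
    (hjk : j ≠ k) :
    Collinear ℝ {cubicCosetPoint n i, cubicCosetPoint n j, cubicCosetPoint n k} ↔
      i + j + k = -1 := by
  rw [cubicCosetPoint, cubicCosetPoint, cubicCosetPoint,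
    collinear_cubicPoint_iff (tan_cubicAngle_injective.ne hij) (tan_cubicAngle_injective.ne hik)
      (tan_cubicAngle_injective.ne hjk),
    tan_add_tan_add_tan_eq_mul_iff (cos_cubicAngle_ne_zero i) (cos_cubicAngle_ne_zero j)
      (cos_cubicAngle_ne_zero k), sin_cubicAngle_add_add_eq_zero_iff]

end Angle

end Cubic

/-- The real affine plane embeds by `φ` into `X`, with `coll` inducing on it its collinear
triples. -/
structure IsPlaneEmbedding {X : Type*} (coll : Set X → Prop) (φ : (Fin 2 → ℝ) → X) : Prop where
  injective : Function.Injective φ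
  coll_iff : ∀ p q r, coll {φ p, φ q, φ r} ↔ Collinear ℝ {p, q, r}

section Affine

theorem collinear_image_iff {k V₁ V₂ P₁ P₂ : Type*} [DivisionRing k] [AddCommGroup V₁]
    [Module k V₁] [AddTorsor V₁ P₁] [AddCommGroup V₂] [Module k V₂] [AddTorsor V₂ P₂]
    {f : P₁ →ᵃ[k] P₂} (hf : Function.Injective f) {s : Set P₁} :
    Collinear k (f '' s) ↔ Collinear k s := by
  rw [Collinear, Collinear, ← AffineMap.map_vectorSpan, ← Cardinal.lift_le_one_iff,
    ← (Submodule.equivMapOfInjective f.linear (f.linear_injective_iff.2 hf) _).lift_rank_eq,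
    Cardinal.lift_le_one_iff]

theorem isLineGeometry_collinear (k : Type*) {V P : Type*} [DivisionRing k] [AddCommGroup V]
    [Module k V] [AddTorsor V P] : IsLineGeometry (Collinear k : Set P → Prop) where
  pair := collinear_pair k
  triple u v a b c huv ha hb hc :=
    collinear_triple_of_mem_affineSpan_pair
      (ha.mem_affineSpan_of_mem_of_ne (by simp) (by simp) (by simp) huv)
      (hb.mem_affineSpan_of_mem_of_ne (by simp) (by simp) (by simp) huv)
      (hc.mem_affineSpan_of_mem_of_ne (by simp) (by simp) (by simp) huv)

theorem exists_isPlaneEmbedding_collinear {E : Type*} [AddCommGroup E] [Module ℝ E]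
    (hE : 2 ≤ Module.rank ℝ E) :
    ∃ φ : (Fin 2 → ℝ) → E, IsPlaneEmbedding (Collinear ℝ) φ := by
  obtain ⟨φ, hφ⟩ := Module.le_rank_iff_exists_linearMap.1 hE
  refine ⟨φ, hφ, fun p q r => ?_⟩
  rw [← collinear_image_iff (f := φ.toAffineMap) hφ]
  simp [Set.image_insert_eq]

end Affine

section Projective

open Projectivization
open scoped LinearAlgebra.Projectivization

variable {K : Type*} [DivisionRing K]

theorem isCollinear_insert_insert_iff {V : Type*} [AddCommGroup V] [Module K V] {u v : V}
    (hu : u ≠ 0) (hv : v ≠ 0) (huv : mk K u hu ≠ mk K v hv) (s : Set (ℙ K V)) :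
    IsCollinear (insert (mk K u hu) (insert (mk K v hv) s)) ↔
      s ⊆ (Submodule.span K {u, v}).projectivization := by
  have hli := huv
  rw [← independent_pair_iff_ne, independent_mk_iff_LinearIndependent] at hli
  have hrank : Module.finrank K (Submodule.span K {u, v}) = 2 := by
    rw [← Matrix.range_cons_cons_empty u v ![], finrank_span_eq_card hli, Fintype.card_fin]
  constructor
  · rintro ⟨M, hfin, hM, hsub⟩
    obtain ⟨W, rfl⟩ := Subspace.submodule.symm.surjective M
    rw [Subspace.submodule.apply_symm_apply] at hfin hM
    simp only [Set.insert_subset_iff, SetLike.mem_coe, Submodule.mk_mem_projectivization_iff]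
      at hsub
    have hle : Submodule.span K {u, v} ≤ W := by
      rw [Submodule.span_le, Set.insert_subset_iff, Set.singleton_subset_iff]
      exact ⟨hsub.1, hsub.2.1⟩
    rw [Submodule.eq_of_le_of_finrank_le hle (hM.trans hrank.ge)]
    exact hsub.2.2
  · intro h
    refine ⟨(Submodule.span K {u, v}).projectivization, ?_, ?_, ?_⟩
    · rw [Subspace.submodule.apply_symm_apply]
      exact Module.Finite.span_of_finite _ (Set.toFinite _)
    · rw [Subspace.submodule.apply_symm_apply, hrank]
    · simp only [Set.insert_subset_iff, SetLike.mem_coe, Submodule.mk_mem_projectivization_iff]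
      exact ⟨Submodule.subset_span (by simp), Submodule.subset_span (by simp), h⟩

theorem isLineGeometry_isCollinear (K : Type*) [DivisionRing K] {V : Type*} [AddCommGroup V]
    [Module K V] : IsLineGeometry (IsCollinear : Set (ℙ K V) → Prop) where
  pair := isCollinear_pair
  triple u v a b c huv ha hb hc := by
    induction u using ind with | h u hu =>
    induction v using ind with | h v hv =>
    refine isCollinear_subset _ _ ((Set.subset_insert _ _).trans (Set.subset_insert _ _))
      ((isCollinear_insert_insert_iff hu hv huv {a, b, c}).2 ?_)
    rw [isCollinear_insert_insert_iff hu hv huv, Set.singleton_subset_iff] at ha hb hc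
    exact Set.insert_subset ha (Set.insert_subset hb (Set.singleton_subset_iff.2 hc))

/-- The affine chart of projective space complementary to the hyperplane `x₀ = 0`. -/
def affineChart {n : ℕ} (p : Fin n → K) : ℙ K (Fin (n + 1) → K) :=
  mk K (Matrix.vecCons 1 p) fun h => one_ne_zero (congrFun h 0)

theorem affineChart_injective {n : ℕ} :
    Function.Injective (affineChart : (Fin n → K) → ℙ K (Fin (n + 1) → K)) := by
  intro p q h
  obtain ⟨t, ht⟩ := (mk_eq_mk_iff' K _ _ _ _).1 h
  rw [Matrix.smul_cons, Matrix.vecCons_inj] at ht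
  obtain ⟨ht1, htq⟩ := ht
  rw [← htq, show t = 1 by simpa using ht1, one_smul]

theorem vecCons_one_mem_span_pair_iff {n : ℕ} {p q r : Fin n → K} :
    (Matrix.vecCons 1 r : Fin (n + 1) → K) ∈
      Submodule.span K {Matrix.vecCons 1 p, Matrix.vecCons 1 q} ↔ r ∈ line[K, p, q] := by
  simp only [Submodule.mem_span_pair, mem_affineSpan_pair_iff_exists_lineMap_eq,
    AffineMap.lineMap_apply_module, Matrix.smul_cons, Matrix.cons_add_cons, smul_eq_mul, mul_one,
    Matrix.vecCons_inj]
  constructor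
  · rintro ⟨s, t, hst, rfl⟩
    exact ⟨t, by rw [← hst, add_sub_cancel_right]⟩
  · rintro ⟨t, rfl⟩
    exact ⟨1 - t, t, sub_add_cancel 1 t, rfl⟩

theorem isCollinear_affineChart_iff {n : ℕ} (p q r : Fin n → K) :
    IsCollinear {affineChart p, affineChart q, affineChart r} ↔ Collinear K {p, q, r} := by
  rcases eq_or_ne p q with rfl | hpq
  · simp [collinear_pair, isCollinear_pair]
  · rw [affineChart, affineChart, affineChart,
      isCollinear_insert_insert_iff _ _ (affineChart_injective.ne hpq), Set.singleton_subset_iff,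
      SetLike.mem_coe, Submodule.mk_mem_projectivization_iff, vecCons_one_mem_span_pair_iff]
    exact ⟨collinear_triple_of_mem_affineSpan_pair (left_mem_affineSpan_pair K p q)
      (right_mem_affineSpan_pair K p q), fun h =>
        h.mem_affineSpan_of_mem_of_ne (by simp) (by simp) (by simp) hpq⟩

theorem isPlaneEmbedding_affineChart :
    IsPlaneEmbedding (IsCollinear : Set (ℙ ℝ (Fin 3 → ℝ)) → Prop) affineChart where
  injective := affineChart_injective
  coll_iff := isCollinear_affineChart_iff

end Projective

theorem mainTheorem5_general {X : Type*} {coll : Set X → Prop} (h : IsLineGeometry coll)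
    {φ : (Fin 2 → ℝ) → X} (hφ : IsPlaneEmbedding coll φ) :
    (∀ n : ℕ, ∃ m : ℕ, IsLeast (totals coll n) m ∧
      (n.choose 2 : ℝ) / 3 ≤ m ∧ (m : ℝ) ≤ (n.choose 2 : ℝ) / 3 + 14 / 3 * n) ∧
    (∀ n : ℕ, ∃ P : Finset X, P.card = n ∧
      (n.choose 2 : ℝ) / 3 - 1 / 3 * n ≤ (collinearSystem coll P).numThreePointRedLines) ∧
    (∀ (A : ℝ) (n : ℕ) (P : Finset X), P.card = n →
      (n.choose 2 : ℝ) / 3 - A * n ≤ (collinearSystem coll P).numThreePointRedLines →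
      ((collinearSystem coll P).numLines : ℝ) ≤
        (n.choose 2 : ℝ) / 3 + (11 * A + 1) * n) := by
  have hex : ∀ n : ℕ, ∃ P : Finset X, P.card = n ∧
      (n.choose 2 : ℝ) / 3 - 1 / 3 * n ≤ (collinearSystem coll P).numThreePointRedLines := by
    intro n
    rcases eq_or_ne n 0 with rfl | hn
    · exact ⟨∅, rfl, by simp⟩
    have : NeZero n := ⟨hn⟩
    have hcubic := h.exists_le_numThreePointRedLines
      (hφ.injective.comp (cubicCosetPoint_injective (n := n))) fun i j k hij hik hjk =>
        (hφ.coll_iff _ _ _).trans (collinear_cubicCosetPoint_iff hij hik hjk)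
    rwa [ZMod.card] at hcubic
  refine ⟨fun n => ?_, hex, ?_⟩
  · obtain ⟨P, rfl, hP⟩ := hex n
    simpa only [show (11 * (1 / 3) + 1 : ℝ) = 14 / 3 by norm_num] using h.exists_isLeast_totals hP
  · rintro A _ P rfl
    exact h.numLines_le

theorem mainTheorem5 :
    -- the minimum total number of lines is `C(n,2)/3 + O(n)`, and at least `C(n,2)/3`
    (∃ C : ℝ, ∀ n : ℕ,
      (∀ d : ℕ, 2 ≤ d → ∃ m : ℕ, IsLeast (totals (euclideanCollinear d) n) m ∧
        (n.choose 2 : ℝ) / 3 ≤ m ∧ (m : ℝ) ≤ (n.choose 2 : ℝ) / 3 + C * n) ∧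
      (∃ m : ℕ, IsLeast (totals projectiveCollinear n) m ∧
        (n.choose 2 : ℝ) / 3 ≤ m ∧ (m : ℝ) ≤ (n.choose 2 : ℝ) / 3 + C * n)) ∧
    -- there are `n`-point sets with `C(n,2)/3 - O(n)` three-point lines
    (∃ A : ℝ, ∀ n : ℕ,
      (∀ d : ℕ, 2 ≤ d → ∃ P : Finset (EuclideanSpace ℝ (Fin d)), P.card = n ∧
        (n.choose 2 : ℝ) / 3 - A * n ≤
          (collinearSystem (euclideanCollinear d) P).numThreePointRedLines) ∧
      (∃ P : Finset RealProjectivePlane, P.card = n ∧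
        (n.choose 2 : ℝ) / 3 - A * n ≤
          (collinearSystem projectiveCollinear P).numThreePointRedLines)) ∧
    -- and every such point set has at most `C(n,2)/3 + O(n)` lines in total
    (∀ A : ℝ, ∃ C : ℝ, ∀ n : ℕ,
      (∀ d : ℕ, 2 ≤ d → ∀ P : Finset (EuclideanSpace ℝ (Fin d)), P.card = n →
        (n.choose 2 : ℝ) / 3 - A * n ≤
          (collinearSystem (euclideanCollinear d) P).numThreePointRedLines →
        ((collinearSystem (euclideanCollinear d) P).numLines : ℝ) ≤
          (n.choose 2 : ℝ) / 3 + C * n) ∧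
      (∀ P : Finset RealProjectivePlane, P.card = n →
        (n.choose 2 : ℝ) / 3 - A * n ≤
          (collinearSystem projectiveCollinear P).numThreePointRedLines →
        ((collinearSystem projectiveCollinear P).numLines : ℝ) ≤
          (n.choose 2 : ℝ) / 3 + C * n)) := by
  have euclidean {d : ℕ} (hd : 2 ≤ d) := mainTheorem5_general
    (isLineGeometry_collinear ℝ (P := EuclideanSpace ℝ (Fin d)))
    (exists_isPlaneEmbedding_collinear (by simpa [← Module.finrank_eq_rank] using hd)).choose_spec
  have projective := mainTheorem5_general (isLineGeometry_isCollinear ℝ)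
    isPlaneEmbedding_affineChart
  exact ⟨⟨_, fun n => ⟨fun d hd => (euclidean hd).1 n, projective.1 n⟩⟩,
    ⟨_, fun n => ⟨fun d hd => (euclidean hd).2.1 n, projective.2.1 n⟩⟩,
    fun A => ⟨_, fun n => ⟨fun d hd => (euclidean hd).2.2 A n, projective.2.2 A n⟩⟩⟩
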